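/- Let $1\le m\le n$ be integers. Let $\mathbb H^n=\mathbb C^n\times\mathbb R$ be the $n$-th Heisenberg group with group law $(z,t)*(w,r)=(z+w,\;t+r-\tfrac12\omega(z,w))$, where $\mathbb C^n=\mathbb R^{2n}$ via $z=x+iy$ and $\omega((x,y),(u,v))=x\cdot v-y\cdot u$ is the standard symplectic form. Equip $\mathbb H^n$ with the Korányi metric $d(p,q)=\|q^{-1}*p\|$, $\|(z,t)\|^4=|z|^4+16t^2$, and let $\mathcal H^\sigma$ denote the $\sigma$-dimensional Hausdorff measure with respect to $d$. Let $G_h(2n,m)$ be the set of $m$-dimensional real linear subspaces $V$ of $\mathbb R^{2n}$ with $\omega|_{V\times V}\equiv 0$ (isotropic planes), and let $\mu_{2n,m}$ be the $U(n)$-invariant Borel probability measure on $G_h(2n,m)$. For $V\in G_h(2n,m)$ let $\mathbb V^\perp=V^\perp\times\mathbb R$, where $V^\perp$ is the Euclidean orthogonal complement of $V$ in $\mathbb R^{2n}$, and let $\mathbb V^\perp*p=\{v*p:v\in\mathbb V^\perp\}$ for $p\in\mathbb H^n$. Theorem. Let $s$ be a real number with $m+2<s\le 2n$ and let $A\subset\mathbb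 H^n$ be a Borel set with $0<\mathcal H^s(A)<\infty$. Then for Lebesgue-almost every $p\in\mathbb H^n=\mathbb R^{2n+1}$, $$\mathcal H^{s-m}\bigl(A\cap(\mathbb V^\perp*p)\bigr)<\infty\quad\text{for }\mu_{2n,m}\text{-almost every }V\in G_h(2n,m).$$ -/

import Mathlib

open MeasureTheory

namespace Heis

/-! ### The symplectic space `ℂⁿ = ℝ²ⁿ` -/

/-- `ℂⁿ`, identified with `ℝ²ⁿ` through `z = x + i y`. As a real inner product space its inner
product is the standard one of `ℝ²ⁿ`. -/
abbrev Cn (n : ℕ) : Type := EuclideanSpace ℂ (Fin n)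

/-- The standard symplectic form `ω((x, y), (u, v)) = x · v - y · u`. -/
def omega {n : ℕ} (z w : Cn n) : ℝ := ∑ i, ((z i).re * (w i).im - (z i).im * (w i).re)

theorem omega_eq {n : ℕ} (z w : Cn n) : omega z w = (inner ℂ z w).im := by
  simp only [omega, PiLp.inner_apply, Complex.im_sum]
  refine Finset.sum_congr rfl fun i _ => ?_
  simp [Complex.mul_im]
  ring

theorem re_inner_eq {n : ℕ} (z w : Cn n) : inner ℝ z w = (inner ℂ z w).re := by
  simp only [PiLp.inner_apply, Complex.re_sum]
  rfl

theorem omega_self {n : ℕ} (z : Cn n) : omega z z = 0 := by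
  simp only [omega]
  exact Finset.sum_eq_zero fun i _ => by ring

theorem omega_add_left {n : ℕ} (z z' w : Cn n) : omega (z + z') w = omega z w + omega z' w := by
  simp only [omega, ← Finset.sum_add_distrib]
  exact Finset.sum_congr rfl fun i _ => by simp; ring

theorem omega_add_right {n : ℕ} (z w w' : Cn n) : omega z (w + w') = omega z w + omega z w' := by
  simp only [omega, ← Finset.sum_add_distrib]
  exact Finset.sum_congr rfl fun i _ => by simp; ring

theorem omega_neg_left {n : ℕ} (z w : Cn n) : omega (-z) w = -omega z w := by
  simp only [omega, ← Finset.sum_neg_distrib]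
  exact Finset.sum_congr rfl fun i _ => by simp; ring

theorem omega_swap {n : ℕ} (z w : Cn n) : omega z w = -omega w z := by
  simp only [omega, ← Finset.sum_neg_distrib]
  exact Finset.sum_congr rfl fun i _ => by ring

/-! ### The Heisenberg group -/

/-- The points `(z, t)` of the `n`-th Heisenberg group `ℍⁿ = ℂⁿ × ℝ`. -/
@[ext]
structure Heisenberg (n : ℕ) : Type where
  z : Cn n
  t : ℝ

variable {n : ℕ}

/-- The group law `(z, t) * (w, s) = (z + w, t + s - ω(z, w) / 2)`. -/
noncomputable instance : Mul (Heisenberg n) :=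
  ⟨fun p q => ⟨p.z + q.z, p.t + q.t - 1 / 2 * omega p.z q.z⟩⟩

instance : One (Heisenberg n) := ⟨⟨0, 0⟩⟩

instance : Inv (Heisenberg n) := ⟨fun p => ⟨-p.z, -p.t⟩⟩

@[simp] theorem mul_z (p q : Heisenberg n) : (p * q).z = p.z + q.z := rfl
@[simp] theorem mul_t (p q : Heisenberg n) :
    (p * q).t = p.t + q.t - 1 / 2 * omega p.z q.z := rfl
@[simp] theorem one_z : (1 : Heisenberg n).z = 0 := rfl
@[simp] theorem one_t : (1 : Heisenberg n).t = 0 := rfl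
@[simp] theorem inv_z (p : Heisenberg n) : (p⁻¹).z = -p.z := rfl
@[simp] theorem inv_t (p : Heisenberg n) : (p⁻¹).t = -p.t := rfl

noncomputable instance : Group (Heisenberg n) :=
  Group.ofLeftAxioms
    (fun p q r => by
      ext1
      · simp [add_assoc]
      · simp [omega_add_left, omega_add_right]; ring)
    (fun p => by ext1 <;> simp [omega])
    (fun p => by ext1 <;> simp [omega_neg_left, omega_self])

/-- The Korányi gauge norm, `‖(z, t)‖⁴ = |z|⁴ + 16 t²`. -/
noncomputable def gauge (p : Heisenberg n) : ℝ := (‖p.z‖ ^ 4 + 16 * p.t ^ 2) ^ (1 / 4 : ℝ)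

theorem gauge_nonneg (p : Heisenberg n) : 0 ≤ gauge p := by unfold gauge; positivity

theorem gauge_pow (p : Heisenberg n) : gauge p ^ 4 = ‖p.z‖ ^ 4 + 16 * p.t ^ 2 := by
  unfold gauge
  rw [← Real.rpow_natCast, ← Real.rpow_mul (by positivity)]
  norm_num

theorem norm_le_gauge (p : Heisenberg n) : ‖p.z‖ ≤ gauge p := by
  refine le_of_pow_le_pow_left₀ (n := 4) (by norm_num) (gauge_nonneg p) ?_
  rw [gauge_pow]
  nlinarith [sq_nonneg p.t]

theorem gauge_sq (p : Heisenberg n) :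
    gauge p ^ 2 = ‖(⟨‖p.z‖ ^ 2, 4 * p.t⟩ : ℂ)‖ := by
  refine (sq_eq_sq₀ (by positivity) (norm_nonneg _)).1 ?_
  rw [Complex.sq_norm, Complex.normSq_mk, ← pow_mul, gauge_pow]
  ring

theorem gauge_mul_le (p q : Heisenberg n) : gauge (p * q) ≤ gauge p + gauge q := by
  refine le_of_sq_le_sq ?_ (add_nonneg (gauge_nonneg p) (gauge_nonneg q))
  have key : (⟨‖(p * q).z‖ ^ 2, 4 * (p * q).t⟩ : ℂ)
      = ⟨‖p.z‖ ^ 2, 4 * p.t⟩ + ⟨‖q.z‖ ^ 2, 4 * q.t⟩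
        + 2 * inner ℂ q.z p.z := by
    apply Complex.ext
    · have := norm_add_sq (𝕜 := ℂ) p.z q.z
      have hs := inner_re_symm (𝕜 := ℂ) p.z q.z
      simp at this hs ⊢
      linarith
    · simp [omega_swap p.z q.z, omega_eq]
      ring
  have hb : ‖(2 * inner ℂ q.z p.z : ℂ)‖ ≤ 2 * (gauge p * gauge q) := by
    rw [norm_mul]
    have h1 := norm_inner_le_norm (𝕜 := ℂ) q.z p.z
    have h2 := mul_le_mul (norm_le_gauge p) (norm_le_gauge q) (norm_nonneg _) (gauge_nonneg p)
    simp
    linarith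
  rw [gauge_sq, key]
  refine (norm_add_le _ _).trans ?_
  have := norm_add_le (⟨‖p.z‖ ^ 2, 4 * p.t⟩ : ℂ) ⟨‖q.z‖ ^ 2, 4 * q.t⟩
  rw [← gauge_sq, ← gauge_sq] at this
  nlinarith

theorem gauge_inv (p : Heisenberg n) : gauge p⁻¹ = gauge p := by simp [gauge]

theorem eq_one_of_gauge {p : Heisenberg n} (h : gauge p = 0) : p = 1 := by
  have h4 := gauge_pow p
  rw [h] at h4
  have hz : 0 ≤ ‖p.z‖ ^ 4 := by positivity
  have h1 : ‖p.z‖ ^ 4 = 0 := by nlinarith [sq_nonneg p.t]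
  have h2 : p.t ^ 2 = 0 := by nlinarith [sq_nonneg p.t]
  ext1
  · simpa using h1
  · simpa using h2

/-- The left-invariant Korányi metric `d(p, q) = ‖q⁻¹ * p‖`. -/
noncomputable instance : MetricSpace (Heisenberg n) where
  dist p q := gauge (q⁻¹ * p)
  dist_self p := by simp [gauge]
  dist_comm p q := by rw [← gauge_inv, mul_inv_rev, inv_inv]
  dist_triangle p q r := by
    have := gauge_mul_le (r⁻¹ * q) (q⁻¹ * p)
    rw [mul_assoc, mul_inv_cancel_left] at this
    linarith
  eq_of_dist_eq_zero {p q} h := (inv_mul_eq_one.1 (eq_one_of_gauge h)).symm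

theorem dist_def (p q : Heisenberg n) : dist p q = gauge (q⁻¹ * p) := rfl

/-- The Korányi metric induces the Euclidean topology of `ℂⁿ × ℝ`. -/
noncomputable def homeo (n : ℕ) : Heisenberg n ≃ₜ Cn n × ℝ where
  toFun p := (p.z, p.t)
  invFun p := ⟨p.1, p.2⟩
  left_inv _ := rfl
  right_inv _ := rfl
  continuous_toFun := by
    have hz : Continuous fun p : Heisenberg n => p.z := by
      refine (LipschitzWith.of_dist_le_mul (K := 1) fun p q => ?_).continuous
      have := norm_le_gauge (q⁻¹ * p)
      rw [dist_def, dist_eq_norm]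
      simpa [neg_add_eq_sub] using this
    refine hz.prodMk (continuous_iff_continuousAt.2 fun q => ?_)
    have hd : Filter.Tendsto (fun p : Heisenberg n => gauge (q⁻¹ * p)) (nhds q) (nhds 0) :=
      tendsto_iff_dist_tendsto_zero.1 Filter.tendsto_id
    have hT : Filter.Tendsto (fun p : Heisenberg n => (q⁻¹ * p).t) (nhds q) (nhds 0) := by
      refine squeeze_zero_norm (fun p => ?_) (by simpa using hd.pow 2)
      refine abs_le_of_sq_le_sq ?_ (by positivity)
      rw [← pow_mul, gauge_pow]
      nlinarith [sq_nonneg (q⁻¹ * p).t, pow_nonneg (norm_nonneg (q⁻¹ * p).z) 4]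
    have hom : Continuous fun p : Heisenberg n => omega q⁻¹.z p.z := by
      unfold omega
      fun_prop
    have h3 := (hT.add_const q.t).add ((hom.tendsto q).const_mul (1 / 2))
    have : omega q⁻¹.z q.z = 0 := by simp [omega_neg_left, omega_self]
    rw [this] at h3
    simp only [mul_t, inv_t] at h3
    refine (h3.congr fun p => by ring).trans (by simp)
  continuous_invFun := by
    refine continuous_iff_continuousAt.2 fun a => tendsto_iff_dist_tendsto_zero.2 ?_
    have : Continuous fun b : Cn n × ℝ =>
        gauge ((⟨a.1, a.2⟩ : Heisenberg n)⁻¹ * ⟨b.1, b.2⟩) := by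
      unfold gauge
      refine Continuous.rpow_const ?_ fun _ => Or.inr (by norm_num)
      simp only [mul_z, mul_t, inv_z, inv_t, omega]
      fun_prop
    have h := this.tendsto a
    simpa [dist_def, gauge, omega_self, omega_neg_left] using h

/-- The Borel σ-algebra of `ℍⁿ`. -/
noncomputable instance : MeasurableSpace (Heisenberg n) := borel _

instance : BorelSpace (Heisenberg n) := ⟨rfl⟩

/-- The Lebesgue measure of `ℍⁿ = ℂⁿ × ℝ = ℝ²ⁿ⁺¹`. -/
noncomputable instance : MeasureSpace (Heisenberg n) :=
  ⟨Measure.map (homeo n).symm (volume : Measure (Cn n × ℝ))⟩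

/-- For a linear subspace `V` of `ℂⁿ = ℝ²ⁿ`, the Euclidean orthogonal complement in `ℂⁿ × ℝ` of the
horizontal set `V × {0}`: it is the vertical subgroup `V^⊥ × ℝ`. -/
def verticalSubgroup (V : Submodule ℝ (Cn n)) : Subgroup (Heisenberg n) where
  carrier := {p | p.z ∈ Vᗮ}
  one_mem' := Vᗮ.zero_mem
  mul_mem' := Vᗮ.add_mem
  inv_mem' := Vᗮ.neg_mem

/-- The right coset `V^⊥ * p` of the vertical subgroup. -/
def verticalCoset (V : Submodule ℝ (Cn n)) (p : Heisenberg n) : Set (Heisenberg n) :=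
  (fun v => v * p) '' (verticalSubgroup V : Set (Heisenberg n))

/-! ### The isotropic Grassmannian and its unitarily invariant probability measure -/

/-- The isotropic Grassmannian `G_h(2n, m)`: the `m`-dimensional real linear subspaces of
`ℂⁿ = ℝ²ⁿ` on which the symplectic form vanishes. -/
def IsotropicGrassmannian (n m : ℕ) : Type :=
  {V : Submodule ℝ (Cn n) // Module.finrank ℝ V = m ∧ ∀ z ∈ V, ∀ w ∈ V, omega z w = 0}

variable {m : ℕ}

/-- The usual topology of the Grassmannian, given by the distance `‖P_V - P_W‖` of the orthogonal
projections. -/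
noncomputable instance : TopologicalSpace (IsotropicGrassmannian n m) :=
  TopologicalSpace.induced (fun V => (V.1.starProjection : Cn n →L[ℝ] Cn n)) inferInstance

noncomputable instance : MeasurableSpace (IsotropicGrassmannian n m) := borel _

instance : BorelSpace (IsotropicGrassmannian n m) := ⟨rfl⟩

/-- The unitary group `U(n)` of `ℂⁿ`. -/
abbrev Un (n : ℕ) : Type := unitary (Cn n →L[ℂ] Cn n)

instance : ContinuousStar (Cn n →L[ℂ] Cn n) :=
  ⟨(star_isometry (E := Cn n →L[ℂ] Cn n)).continuous⟩

instance : CompactSpace (Un n) := by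
  have : ProperSpace (Cn n →L[ℂ] Cn n) := FiniteDimensional.proper ℂ _
  refine isCompact_iff_compactSpace.1 (Metric.isCompact_of_isClosed_isBounded ?_ ?_)
  · have h : ((unitary (Cn n →L[ℂ] Cn n) : Submonoid _) : Set (Cn n →L[ℂ] Cn n))
        = {U | star U * U = 1} ∩ {U | U * star U = 1} := by
      ext U
      exact Unitary.mem_iff
    rw [h]
    exact (isClosed_eq (continuous_star.mul continuous_id) continuous_const).inter
      (isClosed_eq (continuous_id.mul continuous_star) continuous_const)
  · refine (Metric.isBounded_closedBall (x := 0) (r := 1)).subset fun U hU => ?_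
    rw [mem_closedBall_zero_iff]
    refine ContinuousLinearMap.opNorm_le_bound _ zero_le_one fun x => ?_
    rw [one_mul]
    exact ((Unitary.linearIsometryEquiv ⟨U, hU⟩).norm_map x).le

/-- A unitary map as a real linear isometry of `ℂⁿ = ℝ²ⁿ`. -/
noncomputable def realIso (g : Un n) : Cn n ≃ₗᵢ[ℝ] Cn n where
  toLinearEquiv := (Unitary.linearIsometryEquiv g).toLinearEquiv.restrictScalars ℝ
  norm_map' := (Unitary.linearIsometryEquiv g).norm_map

theorem realIso_apply (g : Un n) (x : Cn n) : realIso g x = (g : Cn n →L[ℂ] Cn n) x := rfl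

/-- The action `(g, V) ↦ g V` of the unitary group on the isotropic Grassmannian. -/
noncomputable def rotate (g : Un n) (V : IsotropicGrassmannian n m) :
    IsotropicGrassmannian n m :=
  ⟨V.1.map ((realIso g).toLinearEquiv : Cn n →ₗ[ℝ] Cn n), by
    rw [LinearEquiv.finrank_map_eq]; exact V.2.1, by
    rintro _ ⟨z, hz, rfl⟩ _ ⟨w, hw, rfl⟩
    rw [← V.2.2 z hz w hw, omega_eq, omega_eq]
    exact congrArg Complex.im ((Unitary.linearIsometryEquiv g).inner_map_map z w)⟩

/-- The isotropic plane `ℝᵐ × {0} ⊆ ℝⁿ ⊆ ℂⁿ`. -/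
def basePlane (n m : ℕ) : Submodule ℝ (Cn n) where
  carrier := {z | ∀ i, (z i).im = 0 ∧ (m ≤ i.1 → z i = 0)}
  zero_mem' := by simp
  add_mem' := by
    intro a b ha hb i
    exact ⟨by simp [(ha i).1, (hb i).1], fun h => by simp [(ha i).2 h, (hb i).2 h]⟩
  smul_mem' := by
    intro c a ha i
    exact ⟨by simp [(ha i).1], fun h => by simp [(ha i).2 h]⟩

theorem finrank_basePlane (hmn : m ≤ n) : Module.finrank ℝ (basePlane n m) = m := by
  have e : basePlane n m ≃ₗ[ℝ] (Fin m → ℝ) :=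
    { toFun := fun z i => (z.1 (Fin.castLE hmn i)).re
      map_add' := fun a b => by ext i; simp
      map_smul' := fun c a => by ext i; simp
      invFun := fun x =>
        ⟨WithLp.toLp 2 fun i => if h : i.1 < m then ((x ⟨i.1, h⟩ : ℝ) : ℂ) else 0, by
          intro i
          by_cases h : i.1 < m
          · simp [h]
          · simp [h]⟩
      left_inv := fun z => by
        ext i
        by_cases h : i.1 < m
        · simp only [h, dite_true]
          exact Complex.ext rfl (z.2 i).1.symm
        · simp only [h, dite_false]
          exact ((z.2 i).2 (not_lt.1 h)).symm
      right_inv := fun x => by ext i; simp }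
  rw [e.finrank_eq]
  simp

/-- `basePlane n m` as a point of the isotropic Grassmannian. -/
def basePoint (n m : ℕ) (hmn : m ≤ n) : IsotropicGrassmannian n m :=
  ⟨basePlane n m, finrank_basePlane hmn, fun z hz w hw => by
    simp only [omega]
    exact Finset.sum_eq_zero fun i _ => by rw [(hz i).1, (hw i).1]; ring⟩

/-- The probability measure `μ_{2n,m}` on the isotropic Grassmannian which is invariant under the
unitary group: the image of the Haar probability measure of `U(n)` under an orbit map of the
transitive action of `U(n)`. -/
noncomputable def isotropicMeasure (n m : ℕ) (hmn : m ≤ n) :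
    Measure (IsotropicGrassmannian n m) :=
  Measure.map (fun g : Un n => rotate g (basePoint n m hmn))
    (Measure.haarMeasure (⊤ : TopologicalSpace.PositiveCompacts (Un n)))

theorem starProjection_rotate (g : Un n) (V : IsotropicGrassmannian n m) :
    ((rotate g V).1.starProjection : Cn n →L[ℝ] Cn n)
      = ((g : Cn n →L[ℂ] Cn n).restrictScalars ℝ) ∘L V.1.starProjection ∘L
        ((star (g : Cn n →L[ℂ] Cn n)).restrictScalars ℝ) := by
  ext1 x
  exact Submodule.starProjection_map_apply (realIso g) V.1 x

theorem continuous_restrictScalars :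
    Continuous fun f : Cn n →L[ℂ] Cn n => (f.restrictScalars ℝ : Cn n →L[ℝ] Cn n) :=
  (ContinuousLinearMap.restrictScalarsL ℂ (Cn n) (Cn n) ℝ ℝ).continuous

theorem continuous_rotate_left (V : IsotropicGrassmannian n m) :
    Continuous fun g : Un n => rotate g V := by
  refine continuous_induced_rng.2 ?_
  have h : (fun V : IsotropicGrassmannian n m => (V.1.starProjection : Cn n →L[ℝ] Cn n)) ∘
      (fun g : Un n => rotate g V) = fun g : Un n =>
        ((g : Cn n →L[ℂ] Cn n).restrictScalars ℝ) ∘L V.1.starProjection ∘L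
        ((star (g : Cn n →L[ℂ] Cn n)).restrictScalars ℝ) :=
    funext fun g => starProjection_rotate g V
  rw [h]
  exact (continuous_restrictScalars.comp continuous_subtype_val).clm_comp
    (continuous_const.clm_comp
      (continuous_restrictScalars.comp (continuous_star.comp continuous_subtype_val)))

theorem continuous_rotate_right (g : Un n) :
    Continuous fun V : IsotropicGrassmannian n m => rotate g V := by
  refine continuous_induced_rng.2 ?_
  have h : (fun V : IsotropicGrassmannian n m => (V.1.starProjection : Cn n →L[ℝ] Cn n)) ∘
      (fun V : IsotropicGrassmannian n m => rotate g V) = fun V =>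
        ((g : Cn n →L[ℂ] Cn n).restrictScalars ℝ) ∘L V.1.starProjection ∘L
        ((star (g : Cn n →L[ℂ] Cn n)).restrictScalars ℝ) :=
    funext fun V => starProjection_rotate g V
  rw [h]
  exact continuous_const.clm_comp (continuous_induced_dom.clm_comp continuous_const)

instance (hmn : m ≤ n) : IsProbabilityMeasure (isotropicMeasure n m hmn) := by
  have : IsProbabilityMeasure
      (Measure.haarMeasure (⊤ : TopologicalSpace.PositiveCompacts (Un n))) :=
    ⟨by simpa using Measure.haarMeasure_self (K₀ := (⊤ : TopologicalSpace.PositiveCompacts (Un n)))⟩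
  exact Measure.isProbabilityMeasure_map (continuous_rotate_left _).measurable.aemeasurable

theorem rotate_mul (g h : Un n) (V : IsotropicGrassmannian n m) :
    rotate (g * h) V = rotate g (rotate h V) := by
  apply Subtype.ext
  change Submodule.map _ _ = Submodule.map _ (Submodule.map _ _)
  rw [← Submodule.map_comp]
  rfl

/-- `μ_{2n,m}` is invariant under the unitary group. -/
theorem map_rotate_isotropicMeasure (hmn : m ≤ n) (g : Un n) :
    Measure.map (fun V => rotate g V) (isotropicMeasure n m hmn) = isotropicMeasure n m hmn := by
  unfold isotropicMeasure
  rw [Measure.map_map (continuous_rotate_right g).measurable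
    (continuous_rotate_left _).measurable]
  conv_rhs => rw [← map_mul_left_eq_self
    (Measure.haarMeasure (⊤ : TopologicalSpace.PositiveCompacts (Un n))) g]
  rw [Measure.map_map (continuous_rotate_left _).measurable (measurable_const_mul g)]
  congr 1
  funext h
  exact (rotate_mul g h _).symm

end Heis

/-!
The coset `V^⊥ * p` is the fibre through `p` of the map `q ↦ P_V q.z`, where `P_V` is the orthogonal
projection onto `V`, and this map is 1-Lipschitz for the Korányi metric. The theorem is therefore an
Eilenberg type inequality for these maps, integrated over `V` as well.

For each `k`, let `A` be covered by sets `E_{k,j}` of diameter at most `1 / (k + 1)` with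
`∑ⱼ (diam E_{k,j})^s` bounded by `H^s(A) + 1`, and pick `x_{k,j}` in `E_{k,j}`. The sets `E_{k,j}` that
meet the coset through `z` satisfy `‖P_V z - P_V x_{k,j}‖ ≤ diam E_{k,j}`, so that
`H^{s-m}(A ∩ (V^⊥ * p))` is at most the lower limit in `k` of
`∑ⱼ (diam E_{k,j})^{s-m} 1[‖P_V z - P_V x_{k,j}‖ ≤ diam E_{k,j}]` with `z = p.z`
(`hausdorffMeasure_inter_verticalCoset_le`). Replacing the projections of the covering sets by these
closed balls makes the bound jointly Borel in `(z, V)`, so measurability of the slices in `V` is never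
needed. In a fixed ball of `ℂⁿ`, the slab `‖P_V z - P_V x‖ ≤ δ` has Lebesgue measure `O(δ^m)`
uniformly in `V` and `x` (`volume_slab_inter_ball_le`). By Tonelli and Fatou the lower limit thus has a
finite integral over (ball) × (Grassmannian), hence is finite almost everywhere, and a last
application of Fubini separates the two quantifiers.
-/

open scoped ENNReal
open Metric Filter Topology

namespace Heis

variable {n m : ℕ}

/-! ### Slabs around a plane -/

/-- The linear map which is multiplication by `c` on `V` and the identity on `Vᗮ`. -/
noncomputable def stretch (V : Submodule ℝ (Cn n)) (c : ℝ) : Cn n →ₗ[ℝ] Cn n :=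
  LinearMap.id + (c - 1) • (V.starProjection : Cn n →ₗ[ℝ] Cn n)

theorem stretch_apply (V : Submodule ℝ (Cn n)) (c : ℝ) (z : Cn n) :
    stretch V c z = z + (c - 1) • V.starProjection z := rfl

theorem det_stretch (V : Submodule ℝ (Cn n)) (c : ℝ) :
    LinearMap.det (stretch V c) = c ^ Module.finrank ℝ V := by
  have hinv : V ≤ V.comap (stretch V c) := fun z hz =>
    V.add_mem hz (V.smul_mem _ (Submodule.starProjection_apply_mem V z))
  have hres : (stretch V c).restrict hinv = c • LinearMap.id := by
    ext1 z
    apply Subtype.ext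
    rw [LinearMap.coe_restrict_apply, stretch_apply,
      Submodule.starProjection_eq_self_iff.2 z.2]
    simp [sub_smul]
  have hquot : V.mapQ V (stretch V c) hinv = LinearMap.id := by
    ext1
    ext1 z
    simp only [LinearMap.comp_apply, Submodule.mkQ_apply, Submodule.mapQ_apply, LinearMap.id_apply]
    rw [Submodule.Quotient.eq, stretch_apply, add_sub_cancel_left]
    exact V.smul_mem _ (Submodule.starProjection_apply_mem V z)
  rw [LinearMap.det_eq_det_mul_det V _ hinv, hres, hquot]
  simp

theorem starProjection_stretch (V : Submodule ℝ (Cn n)) (c : ℝ) (z : Cn n) :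
    V.starProjection (stretch V c z) = c • V.starProjection z := by
  rw [stretch_apply, map_add, map_smul,
    Submodule.starProjection_eq_self_iff.2 (Submodule.starProjection_apply_mem V z), sub_smul,
    one_smul, add_sub_cancel]

/-- Stretching by `δ⁻¹` along `V` sends the truncated slab into a ball of radius `R + 1`. -/
theorem volume_slab_inter_ball_le (V : Submodule ℝ (Cn n)) (x : Cn n) {R δ : ℝ} (hδ : 0 < δ) :
    volume ({z : Cn n | ‖V.starProjection z - V.starProjection x‖ ≤ δ} ∩ closedBall 0 R)
      ≤ ENNReal.ofReal δ ^ Module.finrank ℝ V * volume (closedBall (0 : Cn n) (R + 1)) := by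
  have hdet : LinearMap.det (stretch V δ⁻¹) = (δ⁻¹) ^ Module.finrank ℝ V := det_stretch V _
  have hsub : {z : Cn n | ‖V.starProjection z - V.starProjection x‖ ≤ δ} ∩ closedBall 0 R ⊆
      stretch V δ⁻¹ ⁻¹' closedBall (δ⁻¹ • V.starProjection x) (R + 1) := by
    rintro z ⟨hz, hzR⟩
    rw [mem_closedBall_zero_iff] at hzR
    rw [Set.mem_preimage, mem_closedBall, dist_eq_norm]
    have hsplit : stretch V δ⁻¹ z - δ⁻¹ • V.starProjection x
        = (z - V.starProjection z) + δ⁻¹ • (V.starProjection z - V.starProjection x) := by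
      rw [stretch_apply]
      module
    have h1 : ‖z - V.starProjection z‖ ≤ R := by
      rw [← Submodule.starProjection_orthogonal_val]
      exact (Submodule.norm_starProjection_apply_le _ z).trans hzR
    have h2 : ‖δ⁻¹ • (V.starProjection z - V.starProjection x)‖ ≤ 1 := by
      rw [norm_smul, Real.norm_of_nonneg (by positivity), inv_mul_le_iff₀ hδ, mul_one]
      exact hz
    rw [hsplit]
    exact (norm_add_le _ _).trans (add_le_add h1 h2)
  refine (measure_mono hsub).trans ?_
  rw [Measure.addHaar_preimage_linearMap _ (by rw [hdet]; positivity), hdet, ← inv_pow, inv_inv,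
    abs_of_nonneg (by positivity), ENNReal.ofReal_pow hδ.le,
    Measure.addHaar_closedBall_center]

/-! ### Slices by vertical cosets -/

theorem starProjection_eq_of_mem_verticalCoset {V : Submodule ℝ (Cn n)} {p q : Heisenberg n}
    (h : q ∈ verticalCoset V p) : V.starProjection q.z = V.starProjection p.z := by
  obtain ⟨v, hv, rfl⟩ := h
  have hv' : v.z ∈ Vᗮ := hv
  simp [(Submodule.starProjection_apply_eq_zero_iff V).2 hv']

theorem norm_sub_z_le_dist (p q : Heisenberg n) : ‖p.z - q.z‖ ≤ dist p q := by
  have := norm_le_gauge (q⁻¹ * p)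
  rw [dist_def]
  simpa [neg_add_eq_sub] using this

/-- Coverings of `A` of mesh `1 / (k + 1)` whose `s`-sums are uniformly bounded. No nonemptiness
condition is needed on the sets, because `0 ^ s = 0`. -/
theorem exists_covers {X : Type*} [MetricSpace X] [MeasurableSpace X] [BorelSpace X] {s : ℝ}
    (hs : 0 < s) {A : Set X} (hA : Measure.hausdorffMeasure s A < ⊤) (k : ℕ) :
    ∃ E : ℕ → Set X, A ⊆ ⋃ j, E j ∧ (∀ j, ediam (E j) ≤ ((k : ℝ≥0∞) + 1)⁻¹) ∧
      ∑' j, ediam (E j) ^ s ≤ Measure.hausdorffMeasure s A + 1 := by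
  have hlt : Measure.hausdorffMeasure s A < Measure.hausdorffMeasure s A + 1 :=
    ENNReal.lt_add_right hA.ne one_ne_zero
  have hr : (0 : ℝ≥0∞) < ((k : ℝ≥0∞) + 1)⁻¹ := by
    simp [ENNReal.inv_pos]
  have h := Measure.hausdorffMeasure_apply s A
  have hle := (le_iSup₂ (f := fun (r : ℝ≥0∞) (_ : 0 < r) =>
        ⨅ (t : ℕ → Set X) (_ : A ⊆ ⋃ n, t n) (_ : ∀ n, ediam (t n) ≤ r),
          ∑' n, ⨆ _ : (t n).Nonempty, ediam (t n) ^ s) _ hr).trans h.ge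
  have hlt' := hle.trans_lt hlt
  simp only [iInf_lt_iff] at hlt'
  obtain ⟨E, hcov, hdiam, hsum⟩ := hlt'
  refine ⟨E, hcov, hdiam, le_trans (ENNReal.tsum_le_tsum fun j => ?_) hsum.le⟩
  rcases (E j).eq_empty_or_nonempty with he | hne
  · simp [he, hs]
  · exact le_iSup (fun _ : (E j).Nonempty => ediam (E j) ^ s) hne

theorem hausdorffMeasure_inter_verticalCoset_le {d : ℝ} (hd : 0 < d) {A : Set (Heisenberg n)}
    {E : ℕ → ℕ → Set (Heisenberg n)} (hcov : ∀ k, A ⊆ ⋃ j, E k j)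
    (hdiam : ∀ k j, ediam (E k j) ≤ ((k : ℝ≥0∞) + 1)⁻¹)
    {x : ℕ → ℕ → Heisenberg n} (hx : ∀ k j, (E k j).Nonempty → x k j ∈ E k j)
    (V : Submodule ℝ (Cn n)) (p : Heisenberg n) :
    Measure.hausdorffMeasure d (A ∩ verticalCoset V p) ≤ liminf (fun k => ∑' j,
      {z : Cn n | ‖V.starProjection z - V.starProjection (x k j).z‖
        ≤ (ediam (E k j)).toReal}.indicator (fun _ => ediam (E k j) ^ d) p.z) atTop := by
  have hmesh : Tendsto (fun k : ℕ => ((k : ℝ≥0∞) + 1)⁻¹) atTop (𝓝 0) := by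
    have := (tendsto_add_atTop_iff_nat 1).2 ENNReal.tendsto_inv_nat_nhds_zero
    simpa using this
  refine (Measure.hausdorffMeasure_le_liminf_tsum d (A ∩ verticalCoset V p) _ hmesh
    (fun k j => E k j ∩ verticalCoset V p)
    (Eventually.of_forall fun k j => (ediam_mono Set.inter_subset_left).trans (hdiam k j))
    (Eventually.of_forall fun k => ?_)).trans
    (liminf_le_liminf (Eventually.of_forall fun k => ENNReal.tsum_le_tsum fun j => ?_))
  · rw [← Set.iUnion_inter]
    exact Set.inter_subset_inter_left _ (hcov k)
  · rcases (E k j ∩ verticalCoset V p).eq_empty_or_nonempty with he | ⟨y, hy, hyp⟩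
    · simp [he, hd]
    · have hfin : ediam (E k j) ≠ ⊤ := ((hdiam k j).trans_lt (by simp)).ne
      have hmem : p.z ∈ {z : Cn n | ‖V.starProjection z - V.starProjection (x k j).z‖
          ≤ (ediam (E k j)).toReal} := by
        rw [Set.mem_ofPred_eq, ← starProjection_eq_of_mem_verticalCoset hyp, ← map_sub]
        refine (Submodule.norm_starProjection_apply_le V _).trans
          ((norm_sub_z_le_dist y (x k j)).trans ?_)
        exact dist_le_diam_of_mem' hfin hy (hx k j ⟨y, hy⟩)
      rw [Set.indicator_of_mem hmem]
      exact ENNReal.rpow_le_rpow (ediam_mono Set.inter_subset_left) hd.le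

/-! ### Integration over points and planes -/

theorem measurableSet_slab (x : Cn n) (δ : ℝ) :
    MeasurableSet {a : Cn n × IsotropicGrassmannian n m |
      ‖a.2.1.starProjection a.1 - a.2.1.starProjection x‖ ≤ δ} := by
  have hP : Measurable fun V : IsotropicGrassmannian n m =>
      (V.1.starProjection : Cn n →L[ℝ] Cn n) := continuous_induced_dom.measurable
  have hev : Measurable fun b : (Cn n →L[ℝ] Cn n) × Cn n => b.1 b.2 :=
    isBoundedBilinearMap_apply.continuous.measurable
  have h1 : Measurable fun a : Cn n × IsotropicGrassmannian n m => a.2.1.starProjection a.1 :=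
    hev.comp ((hP.comp measurable_snd).prodMk measurable_fst)
  have h2 : Measurable fun a : Cn n × IsotropicGrassmannian n m => a.2.1.starProjection x :=
    hev.comp ((hP.comp measurable_snd).prodMk measurable_const)
  exact measurableSet_le (h1.sub h2).norm measurable_const

/-- The integral over a ball of one term of the majorant is `O((diam)^s)`, uniformly in `V`. -/
theorem lintegral_indicator_slab_le (V : IsotropicGrassmannian n m) (x : Cn n) (R : ℝ) {s : ℝ}
    (hs : (m : ℝ) < s) {δ : ℝ≥0∞} (hδ : δ ≠ ⊤) :
    ∫⁻ z in closedBall (0 : Cn n) R,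
        {z : Cn n | ‖V.1.starProjection z - V.1.starProjection x‖ ≤ δ.toReal}.indicator
          (fun _ => δ ^ (s - m)) z
      ≤ volume (closedBall (0 : Cn n) (R + 1)) * δ ^ s := by
  rcases eq_or_ne δ 0 with rfl | h0
  · simp [ENNReal.zero_rpow_of_pos (sub_pos.2 hs)]
  have hmeas : MeasurableSet
      {z : Cn n | ‖V.1.starProjection z - V.1.starProjection x‖ ≤ δ.toReal} :=
    measurable_prodMk_right (y := V) (measurableSet_slab x δ.toReal)
  have hvol := volume_slab_inter_ball_le V.1 x (R := R) (ENNReal.toReal_pos h0 hδ)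
  rw [ENNReal.ofReal_toReal hδ, V.2.1] at hvol
  rw [lintegral_indicator_const hmeas, Measure.restrict_apply hmeas]
  calc δ ^ (s - m) * volume _
      ≤ δ ^ (s - m) * (δ ^ m * volume (closedBall (0 : Cn n) (R + 1))) := by gcongr
    _ = volume (closedBall (0 : Cn n) (R + 1)) * δ ^ s := by
      rw [← mul_assoc, ← ENNReal.rpow_natCast, ← ENNReal.rpow_add _ _ h0 hδ, sub_add_cancel,
        mul_comm]

/-- The slicing theorem with the point `p` replaced by its `ℂⁿ`-coordinate, on which alone the
vertical coset depends. -/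
theorem ae_ae_hausdorffMeasure_inter_verticalCoset_lt_top {s : ℝ} (hs : (m : ℝ) < s)
    {A : Set (Heisenberg n)} (hA : Measure.hausdorffMeasure s A < ⊤)
    (μ : Measure (IsotropicGrassmannian n m)) [IsFiniteMeasure μ] :
    ∀ᵐ z : Cn n, ∀ᵐ V ∂μ, ∀ t : ℝ,
      Measure.hausdorffMeasure (s - (m : ℝ)) (A ∩ verticalCoset V.1 ⟨z, t⟩) < ⊤ := by
  have hs0 : 0 < s := (Nat.cast_nonneg m).trans_lt hs
  choose E hcov hdiam hsum using fun k => exists_covers hs0 hA k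
  have hne : ∀ k j, ∃ x, (E k j).Nonempty → x ∈ E k j := fun k j => by
    rcases (E k j).eq_empty_or_nonempty with he | ⟨x, hx⟩
    · exact ⟨1, by simp [he]⟩
    · exact ⟨x, fun _ => hx⟩
  choose x hx using hne
  have hfin : ∀ k j, ediam (E k j) ≠ ⊤ := fun k j => ((hdiam k j).trans_lt (by simp)).ne
  let g : ℕ → ℕ → Cn n × IsotropicGrassmannian n m → ℝ≥0∞ := fun k j =>
    {a | ‖a.2.1.starProjection a.1 - a.2.1.starProjection (x k j).z‖
      ≤ (ediam (E k j)).toReal}.indicator fun _ => ediam (E k j) ^ (s - m)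
  have hg : ∀ k j, Measurable (g k j) := fun k j =>
    measurable_const.indicator (measurableSet_slab _ _)
  have hG : ∀ k, Measurable fun a => ∑' j, g k j a := fun k => Measurable.tsum (hg k)
  have hball : ∀ N : ℕ, ∀ᵐ z ∂((volume : Measure (Cn n)).restrict (closedBall 0 N)), ∀ᵐ V ∂μ,
      liminf (fun k => ∑' j, g k j (z, V)) atTop < ⊤ := by
    intro N
    refine Measure.ae_ae_of_ae_prod (p := fun a => liminf (fun k => ∑' j, g k j a) atTop < ⊤)
      (ae_lt_top (Measurable.liminf hG) (ne_of_lt ?_))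
    let C : ℝ≥0∞ := volume (closedBall (0 : Cn n) (N + 1)) *
      (Measure.hausdorffMeasure s A + 1) * μ Set.univ
    have hC : C < ⊤ := ENNReal.mul_lt_top (ENNReal.mul_lt_top measure_closedBall_lt_top
      (ENNReal.add_lt_top.2 ⟨hA, ENNReal.one_lt_top⟩)) (measure_lt_top μ _)
    refine (lintegral_liminf_le hG).trans_lt (lt_of_le_of_lt ?_ hC)
    -- The bound holds for every `k`, so one `k` that witnesses the lower limit suffices.
    refine liminf_le_of_le (by isBoundedDefault) fun b hb => ?_
    obtain ⟨k, hk⟩ := hb.exists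
    refine hk.trans ?_
    rw [lintegral_prod_symm' _ (hG k)]
    have hV : ∀ V : IsotropicGrassmannian n m,
        ∫⁻ z in closedBall (0 : Cn n) N, ∑' j, g k j (z, V)
          ≤ volume (closedBall (0 : Cn n) (N + 1)) * (Measure.hausdorffMeasure s A + 1) := by
      intro V
      have hmeas : ∀ j, Measurable fun z => g k j (z, V) := fun j =>
        (hg k j).comp measurable_prodMk_right
      rw [lintegral_tsum fun j => (hmeas j).aemeasurable]
      refine (ENNReal.tsum_le_tsum fun j =>
        lintegral_indicator_slab_le V (x k j).z N hs (hfin k j)).trans ?_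
      rw [ENNReal.tsum_mul_left]
      gcongr
      exact hsum k
    exact (lintegral_mono hV).trans (lintegral_const _).le
  have hall : ∀ᵐ z : Cn n, ∀ᵐ V ∂μ, liminf (fun k => ∑' j, g k j (z, V)) atTop < ⊤ := by
    have hN := ae_all_iff.2 fun N : ℕ => (ae_restrict_iff' measurableSet_closedBall).1 (hball N)
    filter_upwards [hN] with z hz
    obtain ⟨N, hN⟩ := exists_nat_ge ‖z‖
    exact hz N (mem_closedBall_zero_iff.2 hN)
  filter_upwards [hall] with z hz
  filter_upwards [hz] with V hV t
  exact (hausdorffMeasure_inter_verticalCoset_le (sub_pos.2 hs) hcov hdiam hx V.1 ⟨z, t⟩).trans_lt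
    hV

theorem ae_of_ae_z {P : Cn n → Prop} (h : ∀ᵐ z : Cn n, P z) : ∀ᵐ p : Heisenberg n, P p.z := by
  have h1 : ∀ᵐ a : Cn n × ℝ, P a.1 := Measure.quasiMeasurePreserving_fst.ae h
  exact ((homeo n).symm.measurableEmbedding.ae_map_iff).2 h1

end Heis

theorem mainTheorem8 (n m : ℕ) (hm : 0 < m) (hmn : m ≤ n) (s : ℝ) (hs : (m : ℝ) + 2 < s)
    (hs' : s ≤ 2 * (n : ℝ)) (A : Set (Heis.Heisenberg n)) (hA : MeasurableSet A)
    (hpos : 0 < Measure.hausdorffMeasure s A) (hfin : Measure.hausdorffMeasure s A < ⊤) :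
    ∀ᵐ p : Heis.Heisenberg n, ∀ᵐ V ∂(Heis.isotropicMeasure n m hmn),
      Measure.hausdorffMeasure (s - (m : ℝ)) (A ∩ Heis.verticalCoset V.1 p) < ⊤ := by
  have h := Heis.ae_of_ae_z (Heis.ae_ae_hausdorffMeasure_inter_verticalCoset_lt_top
    (by linarith : (m : ℝ) < s) hfin (Heis.isotropicMeasure n m hmn))
  filter_upwards [h] with p hp
  filter_upwards [hp] with V hV
  exact hV p.t
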